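/- Let $R$ be a finite set of attributes, each attribute $A$ having a domain $\mathrm{Dom}(A)$, where infinitely many values are common to all the domains (for example, all domains are equal to one infinite set). A tuple is a map $t$ on $R$ with $t(A)\in\mathrm{Dom}(A)$, and a relation is a non-empty set $r$ of tuples. For sets $X,Y\subseteq R$ and sequences $A_1\dots A_n$, $B_1\dots B_n$ of distinct attributes, consider: - functional dependencies (FDs) $X\to Y$: any $t,t'\in r$ that agree on $X$ agree on $Y$; - inclusion dependencies (INDs) $A_1\dots A_n\subseteq B_1\dots B_n$: for every $t\in r$ there is $t'\in r$ with $t(A_i)=t'(B_i)$ for all $i$; - independence atoms (IAs) $X\perp Y$ ($X,Y$ not necessarily disjoint): for all $t,t'\in r$ there is $t''\in r$ that agrees with $t$ on $X$ and with $t'$ on $Y$. A UFD is an FD $X\to Y$ with $|X|,|Y|\le 1$, and a UIND is an IND $A\subseteq B$ between single attributes. UFD+UIND+IA is the class of all UFDs, UINDs and IAs over $R$. Write $\Sigma\models_{\mathrm{fin}}\sigma$ if every finite relation that satisfies all dependencies in $\Sigma$ satisfies $\sigma$. Consider the following rules, where $XY$ denotes $X\cup Y$: - IAs: $\emptyset\perp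 X$ (trivial independence); $X\perp Y\Rightarrow Y\perp X$ (symmetry); $X\perp YZ\Rightarrow X\perp Y$ (decomposition); $X\perp Y,\ XY\perp Z\Rightarrow X\perp YZ$ (exchange); - FDs: $XY\to Y$ (reflexivity); $X\to Y,\ Y\to Z\Rightarrow X\to Z$ (transitivity); - IAs and FDs: $X\perp Y,\ X\to Y\Rightarrow\emptyset\to Y$ (constancy); $X\perp YZ,\ Z\to V\Rightarrow X\perp YZV$ (composition); - INDs, for sequences $X,Y,Z$: $X\subseteq X$ (reflexivity); $X\subseteq Y,\ Y\subseteq Z\Rightarrow X\subseteq Z$ (transitivity); - for every $n\ge1$ the cycle rule $\mathcal C_n$: from $A_{2i-1}\to A_{2i}$ and $A_{2i+1}\subseteq A_{2i}$ for all $i=1,\dots,n$, where $A_{2n+1}:=A_1$, conclude any of $A_{2i}\to A_{2i-1}$ and $A_{2i}\subseteq A_{2i+1}$, $i=1,\dots,n$. A deduction from $\Sigma$ is a finite sequence of dependencies each of which lies in $\Sigma$ or follows from earlier ones by a rule; $\Sigma\vdash\sigma$ means that some deduction from $\Sigma$ ends in $\sigma$. **Theorem.** The rules are sound and complete for finite implication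 of UFD+UIND+IA: for every finite set $\Sigma\cup\{\sigma\}$ of UFDs, UINDs and IAs, $$\Sigma\vdash\sigma\iff\Sigma\models_{\mathrm{fin}}\sigma .$$ Moreover, if $\Sigma\models_{\mathrm{fin}}\sigma$, then $\sigma$ has a deduction from $\Sigma$ that consists of UFDs, UINDs and IAs only and in which only attributes appearing in $\Sigma$ or $\sigma$ occur. Furthermore, every finite set $\Sigma$ of UFDs, UINDs and IAs has a finite Armstrong relation with respect to finite implication, i.e. a finite relation $r$ such that for every UFD, UIND or IA $\sigma$ over $R$, $r$ satisfies $\sigma$ if and only if $\Sigma\models_{\mathrm{fin}}\sigma$. -/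

import Mathlib

namespace DependencyTheory

/-- Dependencies over a (single) relation schema, whose attributes are the elements of `α`. -/
inductive Dep (α : Type*) where
  /-- The functional dependency `X → Y`. -/
  | fd (X Y : Finset α) : Dep α
  /-- The inclusion dependency `A₁ … Aₙ ⊆ B₁ … Bₙ` between sequences of distinct attributes. -/
  | ind (n : ℕ) (A B : Fin n ↪ α) : Dep α
  /-- The independence atom `X ⊥ Y`; the sets `X` and `Y` need not be disjoint. -/
  | ia (X Y : Finset α) : Dep α

namespace Dep

variable {α : Type*}

/-- The sequence of length one that consists of the attribute `A`. -/
def single (A : α) : Fin 1 ↪ α :=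
  ⟨fun _ => A, fun _ _ _ => Subsingleton.elim _ _⟩

/-- The unary inclusion dependency `A ⊆ B`. -/
def uind (A B : α) : Dep α := ind 1 (single A) (single B)

/-- The class UFD+UIND+IA: functional dependencies with at most one attribute on either side,
inclusion dependencies between single attributes, and arbitrary independence atoms. -/
def IsUFDorUINDorIA : Dep α → Prop
  | fd X Y => X.card ≤ 1 ∧ Y.card ≤ 1
  | ind n _ _ => n = 1
  | ia _ _ => True

/-- The attributes that appear in a dependency. -/
def attrs : Dep α → Set α
  | fd X Y => ↑X ∪ ↑Y
  | ind _ A B => Set.range A ∪ Set.range B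
  | ia X Y => ↑X ∪ ↑Y

end Dep

/-! ### Relations, satisfaction, finite implication -/

/-- A relation: a non-empty set of tuples `t`, where `t A` lies in the domain `Dom A` of the
attribute `A`. -/
structure Rel {α V : Type*} (Dom : α → Set V) where
  tuples : Set (α → V)
  nonempty : tuples.Nonempty
  mem_dom : ∀ t ∈ tuples, ∀ A, t A ∈ Dom A

namespace Rel

variable {α V : Type*} {Dom : α → Set V}

/-- Satisfaction of a dependency in a relation. -/
def Sat (r : Rel Dom) : Dep α → Prop
  | .fd X Y => ∀ t ∈ r.tuples, ∀ t' ∈ r.tuples, (∀ A ∈ X, t A = t' A) → ∀ A ∈ Y, t A = t' A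
  | .ind _ A B => ∀ t ∈ r.tuples, ∃ t' ∈ r.tuples, ∀ i, t (A i) = t' (B i)
  | .ia X Y => ∀ t ∈ r.tuples, ∀ t' ∈ r.tuples, ∃ t'' ∈ r.tuples,
      (∀ A ∈ X, t'' A = t A) ∧ (∀ A ∈ Y, t'' A = t' A)

end Rel

/-- Finite implication: every finite relation that satisfies all of `Γ` satisfies `σ`. -/
def FinImplies {α V : Type*} (Dom : α → Set V) (Γ : Set (Dep α)) (σ : Dep α) : Prop :=
  ∀ r : Rel Dom, r.tuples.Finite → (∀ τ ∈ Γ, r.Sat τ) → r.Sat σ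

/-- `r` is an Armstrong relation for `Γ` with respect to finite implication and the class `C`:
it satisfies exactly those dependencies of `C` that `Γ` finitely implies. -/
def IsFinArmstrong {α V : Type*} {Dom : α → Set V} (C : Dep α → Prop) (Γ : Set (Dep α))
    (r : Rel Dom) : Prop :=
  ∀ σ, C σ → (r.Sat σ ↔ FinImplies Dom Γ σ)

/-! ### Axiomatizations and deductions -/

/-- An axiomatization, given by the instances of its rules: `𝓡 P σ` says that the conclusion `σ`
follows from the set of premises `P` by one application of a rule. -/
abbrev Axiomatization (α : Type*) := Set (Dep α) → Dep α → Prop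

/-- A deduction from `Γ`: each line is an element of `Γ` or follows from earlier lines by an
application of a rule. -/
def IsDeduction {α : Type*} (𝓡 : Axiomatization α) (Γ : Set (Dep α)) (l : List (Dep α)) : Prop :=
  ∀ (i : ℕ) (hi : i < l.length),
    l[i] ∈ Γ ∨ ∃ P : Set (Dep α), 𝓡 P l[i] ∧ ∀ τ ∈ P, τ ∈ l.take i

/-- `Γ ⊢ σ`: some deduction from `Γ` has `σ` as its last line. -/
def Deducible {α : Type*} (𝓡 : Axiomatization α) (Γ : Set (Dep α)) (σ : Dep α) : Prop :=
  ∃ l : List (Dep α), IsDeduction 𝓡 Γ l ∧ l.getLast? = some σ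

/-- Some deduction of `σ` from `Γ` uses only dependencies of the class `C`, and in it only
attributes that appear in `Γ` or `σ`. -/
def BoundedDeducible {α : Type*} (𝓡 : Axiomatization α) (C : Dep α → Prop)
    (Γ : Set (Dep α)) (σ : Dep α) : Prop :=
  ∃ l : List (Dep α), IsDeduction 𝓡 Γ l ∧ l.getLast? = some σ ∧
    ∀ τ ∈ l, C τ ∧ τ.attrs ⊆ (⋃ γ ∈ Γ, γ.attrs) ∪ σ.attrs

/-! ### The rules -/

/-- The rules for independence atoms and functional dependencies, without weak composition and
augmentation. -/
inductive AStar {α : Type*} [DecidableEq α] : Set (Dep α) → Dep α → Prop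
  | trivialIndependence (X : Finset α) : AStar ∅ (.ia ∅ X)
  | symmetry (X Y : Finset α) : AStar {.ia X Y} (.ia Y X)
  | decomposition (X Y Z : Finset α) : AStar {.ia X (Y ∪ Z)} (.ia X Y)
  | exchange (X Y Z : Finset α) : AStar {.ia X Y, .ia (X ∪ Y) Z} (.ia X (Y ∪ Z))
  | reflexivity (X Y : Finset α) : AStar ∅ (.fd (X ∪ Y) Y)
  | transitivity (X Y Z : Finset α) : AStar {.fd X Y, .fd Y Z} (.fd X Z)
  | constancy (X Y : Finset α) : AStar {.ia X Y, .fd X Y} (.fd ∅ Y)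
  | composition (X Y Z V : Finset α) :
      AStar {.ia X (Y ∪ Z), .fd Z V} (.ia X (Y ∪ Z ∪ V))

/-- Reflexivity and transitivity for inclusion dependencies. -/
inductive IndRules {α : Type*} : Set (Dep α) → Dep α → Prop
  | reflexivity (n : ℕ) (A : Fin n ↪ α) : IndRules ∅ (.ind n A A)
  | transitivity (n : ℕ) (A B C : Fin n ↪ α) :
      IndRules {.ind n A B, .ind n B C} (.ind n A C)

/-- The premises of the cycle rule for `n = k + 1`. With `A₁, A₃, …, A₂ₙ₋₁` written `A 0, …, A k`
and `A₂, A₄, …, A₂ₙ` written `B 0, …, B k`, these are `A i → B i` and `B i ⊇ A (i + 1)`, where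
`i + 1` is taken cyclically in `Fin (k + 1)`. -/
def cyclePremises {α : Type*} {k : ℕ} (A B : Fin (k + 1) → α) : Set (Dep α) :=
  Set.range (fun i => Dep.fd {A i} {B i}) ∪ Set.range (fun i => Dep.uind (A (i + 1)) (B i))

/-- The cycle rule for `n = k + 1`: each of the reversed dependencies may be concluded. -/
inductive CycleRule {α : Type*} (k : ℕ) : Set (Dep α) → Dep α → Prop
  | fd (A B : Fin (k + 1) → α) (i : Fin (k + 1)) :
      CycleRule k (cyclePremises A B) (.fd {B i} {A i})
  | ind (A B : Fin (k + 1) → α) (i : Fin (k + 1)) :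
      CycleRule k (cyclePremises A B) (.uind (B i) (A (i + 1)))

/-- The rules `AStar`, reflexivity and transitivity of inclusion dependencies, and the cycle rules
for all `n ≥ 1`. -/
def finRules {α : Type*} [DecidableEq α] : Axiomatization α :=
  fun P σ => AStar P σ ∨ IndRules P σ ∨ ∃ k : ℕ, CycleRule k P σ

end DependencyTheory

/-!
The rules only derive what holds in every finite relation: the cycle rule is a count of column
values, since around the cycle no column can be larger than the previous one.

Conversely, for any set `S` of attributes there is one finite relation that satisfies exactly the
dependencies over `S` which have a deduction inside `S` and inside the class
(`exists_rel_sat_iff_derivableWithin`). Taking for `S` the attributes of `Γ` and `σ` gives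
completeness with bounded deductions; taking all attributes gives an Armstrong relation, as
"derivable" and "finitely implied" then coincide.

The derivable dependencies form a `ClosedTheory`, a purely combinatorial object, and
`ClosedTheory.exists_realization` builds the relation from it in two steps.

* Up to renaming of values, column by column, a tuple is a vector of bits over the two-element
  field. A bit belongs to an attribute, and the column of `A` shows the bits of the non-constant
  attributes determined by `A`; this makes the functional dependencies exactly right. There are
  free bits, and for each pair of sets `(X, Y)` one bit per attribute; if `(X, Y)` is `Critical`
  (a minimal pair that is not independent, and whose closures share only constants), then these
  bits have even sum over `X ∪ Y`. This constraint violates `X ⊥ Y`, and by the exchange rule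
  (`ClosedTheory.indep_glue`, `ClosedTheory.Critical.subset_closure`) it respects every
  independence atom of the theory.
* Inclusion dependencies are arranged by renaming values, for which only column sizes matter. The
  cycle rule yields a rank of the attributes (`ClosedTheory.exists_rank`) which increases along
  inclusions and decreases along functional dependencies, and is constant only along edges that
  can be reversed. The numbers of free bits are chosen (`exists_weight`) so that the size of a
  column depends on the rank alone and grows quickly with it. The columns can then be renamed onto
  finite sets that are nested exactly as the theory demands (`exists_nested_finsets`).
-/

namespace DependencyTheory

/-! ### Closed theories -/

/-- A set of unary functional dependencies, unary inclusion dependencies and independence atoms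
that is closed under the rules: `const A` stands for `∅ → A`, `det A B` for `A → B`,
`sub A B` for `A ⊆ B` and `indep X Y` for `X ⊥ Y`. -/
structure ClosedTheory (β : Type*) [DecidableEq β] where
  const : β → Prop
  det : β → β → Prop
  sub : β → β → Prop
  indep : Finset β → Finset β → Prop
  det_refl : ∀ A, det A A
  det_trans : ∀ {A B C}, det A B → det B C → det A C
  det_of_const : ∀ {A B}, const B → det A B
  const_of_det : ∀ {A B}, const A → det A B → const B
  sub_refl : ∀ A, sub A A
  sub_trans : ∀ {A B C}, sub A B → sub B C → sub A C
  cycle : ∀ {k : ℕ} (A B : Fin (k + 1) → β), (∀ i, det (A i) (B i)) →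
    (∀ i, sub (A (i + 1)) (B i)) → ∀ i, det (B i) (A i) ∧ sub (B i) (A (i + 1))
  indep_empty : ∀ X, indep ∅ X
  indep_symm : ∀ {X Y}, indep X Y → indep Y X
  indep_decomposition : ∀ {X Y Z}, indep X (Y ∪ Z) → indep X Y
  indep_exchange : ∀ {X Y Z}, indep X Y → indep (X ∪ Y) Z → indep X (Y ∪ Z)
  indep_constancy : ∀ {A B}, indep {A} {B} → det A B → const B
  indep_det : ∀ {X Y B C}, indep X (Y ∪ {B}) → det B C → indep X (Y ∪ {B} ∪ {C})
  indep_const : ∀ {X Y C}, indep X Y → const C → indep X (Y ∪ {C})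

namespace ClosedTheory

variable {β : Type*} [DecidableEq β] (T : ClosedTheory β)

section Rank

/-- An attribute included in a constant one is constant, by the cycle rule for one pair. -/
theorem const_of_sub {A B : β} (hB : T.const B) (h : T.sub A B) : T.const A := by
  have := (T.cycle (k := 0) (fun _ => A) (fun _ => B) (fun _ => T.det_of_const hB)
    (fun _ => h) 0).1
  exact T.const_of_det hB this

/-- One step of size comparison: the values of `B` are among those of an attribute determined
by `A`, so that in a finite relation the column of `B` is at most as large as that of `A`. -/
def link (A B : β) : Prop := ∃ C, T.det A C ∧ T.sub B C

theorem exists_seq_of_reflTransGen {γ : Type*} {r : γ → γ → Prop} {a b : γ}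
    (h : Relation.ReflTransGen r a b) :
    ∃ (n : ℕ) (f : ℕ → γ), f 0 = a ∧ f n = b ∧ ∀ i < n, r (f i) (f (i + 1)) := by
  induction h with
  | refl => exact ⟨0, fun _ => a, rfl, rfl, by simp⟩
  | @tail b c _ hbc ih =>
    obtain ⟨n, f, h0, hn, hf⟩ := ih
    refine ⟨n + 1, fun i => if i ≤ n then f i else c, by simpa using h0, by simp, ?_⟩
    intro i hi
    rcases Nat.lt_or_ge i n with h | h
    · simpa [h.le, Nat.succ_le_of_lt h] using hf i h
    · obtain rfl : i = n := by omega
      simpa [hn] using hbc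

/-- The cycle rule for chains of links: if links lead from `B` back to `A`, then the edges of
the link from `A` to `B` can be reversed. -/
theorem cycle_of_reflTransGen {A B C : β} (h : Relation.ReflTransGen T.link B A)
    (hdet : T.det A C) (hsub : T.sub B C) : T.det C A ∧ T.sub C B := by
  obtain ⟨n, f, h0, hn, hf⟩ := exists_seq_of_reflTransGen h
  have : Nonempty β := ⟨A⟩
  choose! g hg using hf
  have key := T.cycle (k := n) (fun i => f i) (fun i => if (i : ℕ) < n then g i else C) ?_ ?_
    (Fin.last n)
  · simpa [hn, h0] using key
  · intro i
    by_cases hi : (i : ℕ) < n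
    · simpa [hi] using (hg i hi).1
    · have : (i : ℕ) = n := by omega
      simpa [this, hn] using hdet
  · intro i
    by_cases hi : (i : ℕ) < n
    · have : ((i + 1 : Fin (n + 1)) : ℕ) = i + 1 :=
        Fin.val_add_one_of_lt (by rw [Fin.lt_def]; simpa using hi)
      simpa [hi, this] using (hg i hi).2
    · have : i = Fin.last n := by ext; simp; omega
      simpa [this, h0] using hsub

theorem link_of_det {A B : β} (h : T.det A B) : T.link A B := ⟨B, h, T.sub_refl B⟩

theorem link_of_sub {A B : β} (h : T.sub A B) : T.link B A := ⟨B, T.det_refl B, h⟩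

theorem const_of_reflTransGen {A B : β} (h : Relation.ReflTransGen T.link A B)
    (hA : T.const A) : T.const B := by
  induction h with
  | refl => exact hA
  | tail _ hbc ih =>
    obtain ⟨C, h1, h2⟩ := hbc
    exact T.const_of_sub (T.const_of_det ih h1) h2

open Classical in
/-- A rank of the attributes by forced column size. It is `0` for the constants, and otherwise one
more than the number of attributes whose column is forced to be smaller, but not to be equal, in
size. By the cycle rule, edges between attributes of equal rank can be reversed. -/
theorem exists_rank [Finite β] : ∃ ρ : β → ℕ,
    (∀ A, ρ A = 0 ↔ T.const A) ∧
    (∀ A B, T.det A B → ρ B ≤ ρ A ∧ (ρ A = ρ B → T.det B A)) ∧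
    (∀ A B, T.sub A B → ρ A ≤ ρ B ∧ (ρ A = ρ B → T.sub B A)) := by
  have := Fintype.ofFinite β
  let R := Relation.ReflTransGen T.link
  let low : β → Finset β := fun A => Finset.univ.filter (fun C => R A C ∧ ¬ R C A)
  let ρ : β → ℕ := fun A => if T.const A then 0 else (low A).card + 1
  have hlow : ∀ {A B}, R A B → low B ⊆ low A := by
    intro A B h C hC
    simp only [low, Finset.mem_filter, Finset.mem_univ, true_and] at hC ⊢
    exact ⟨h.trans hC.1, fun h' => hC.2 (h'.trans h)⟩
  have hmono : ∀ {A B}, R A B → ρ B ≤ ρ A := by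
    intro A B h
    by_cases hA : T.const A
    · simp [ρ, hA, T.const_of_reflTransGen h hA]
    · by_cases hB : T.const B
      · simp [ρ, hB]
      · simpa [ρ, hA, hB] using Finset.card_le_card (hlow h)
  have heq : ∀ {A B}, R A B → ρ A = ρ B → R B A := by
    intro A B h e
    by_cases hA : T.const A
    · exact .single (T.link_of_det (T.det_of_const hA))
    · by_cases hB : T.const B
      · simp [ρ, hA, hB] at e
      · by_contra hBA
        have hB' : B ∈ low B := by
          rw [Finset.eq_of_subset_of_card_le (hlow h) (by simpa [ρ, hA, hB] using e.le)]
          simp [low, hBA, h]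
        simp [low] at hB'
  refine ⟨ρ, fun A => by by_cases h : T.const A <;> simp [ρ, h], fun A B h => ?_, fun A B h => ?_⟩
  · have hl : R A B := .single (T.link_of_det h)
    exact ⟨hmono hl, fun e => (T.cycle_of_reflTransGen (heq hl e) h (T.sub_refl B)).1⟩
  · have hl : R B A := .single (T.link_of_sub h)
    exact ⟨hmono hl, fun e => (T.cycle_of_reflTransGen (heq hl e.symm) (T.det_refl B) h).2⟩

end Rank

section Independence

variable {T}

theorem indep_mono {X Y X' Y' : Finset β} (h : T.indep X Y) (hX : X' ⊆ X) (hY : Y' ⊆ Y) :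
    T.indep X' Y' := by
  have h1 : T.indep X Y' :=
    T.indep_decomposition (Z := Y) (by rwa [Finset.union_eq_right.2 hY])
  exact T.indep_symm (T.indep_decomposition (Z := X)
    (by rw [Finset.union_eq_right.2 hX]; exact T.indep_symm h1))

/-- The attributes that are constant or determined by an attribute of `X`. With unary functional
dependencies, this is the set of all attributes determined by `X`. -/
def closure (T : ClosedTheory β) (X : Finset β) : Set β :=
  {C | T.const C ∨ ∃ A ∈ X, T.det A C}

theorem indep_closure_right {X Y Y' : Finset β} (h : T.indep X Y)
    (hY : ∀ C ∈ Y', C ∈ T.closure Y) : T.indep X Y' := by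
  suffices H : T.indep X (Y ∪ Y') from indep_mono H subset_rfl Finset.subset_union_right
  induction Y' using Finset.induction_on with
  | empty => simpa using h
  | insert C Y' _ ih =>
    have ih := ih fun D hD => hY D (Finset.mem_insert_of_mem hD)
    have e : Y ∪ insert C Y' = (Y ∪ Y') ∪ {C} := by
      ext; simp only [Finset.mem_union, Finset.mem_insert, Finset.mem_singleton]; tauto
    rw [e]
    rcases hY C (Finset.mem_insert_self _ _) with hC | ⟨B, hB, hBC⟩
    · exact T.indep_const ih hC
    · have e' : (Y ∪ Y') ∪ {B} = Y ∪ Y' :=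
        Finset.union_eq_left.2 (by simpa using Or.inl hB)
      have := T.indep_det (Y := Y ∪ Y') (B := B) (by rwa [e']) hBC
      rwa [e'] at this

theorem indep_closure {X Y X' Y' : Finset β} (h : T.indep X Y)
    (hX : ∀ C ∈ X', C ∈ T.closure X) (hY : ∀ C ∈ Y', C ∈ T.closure Y) : T.indep X' Y' :=
  indep_closure_right (T.indep_symm (indep_closure_right (T.indep_symm h) hX)) hY

theorem const_of_mem_closure {X Y : Finset β} {C : β} (h : T.indep X Y)
    (hX : C ∈ T.closure X) (hY : C ∈ T.closure Y) : T.const C :=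
  T.indep_constancy (A := C) (indep_closure h (by simpa using hX) (by simpa using hY))
    (T.det_refl C)

/-- Two independent pairs may be united if they are independent of one another; this is exchange,
used three times. -/
theorem indep_glue {P₁ P₂ Q₁ Q₂ : Finset β} (h₁ : T.indep P₁ Q₁) (h₂ : T.indep P₂ Q₂)
    (h : T.indep (P₁ ∪ Q₁) (P₂ ∪ Q₂)) : T.indep (P₁ ∪ P₂) (Q₁ ∪ Q₂) := by
  have a : T.indep Q₁ (P₁ ∪ P₂) := T.indep_exchange (T.indep_symm h₁)
    (indep_mono h (Finset.union_comm _ _).subset Finset.subset_union_left)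
  have b : T.indep Q₂ (P₂ ∪ (P₁ ∪ Q₁)) := T.indep_exchange (T.indep_symm h₂)
    (by rw [Finset.union_comm Q₂]; exact T.indep_symm h)
  refine T.indep_exchange (T.indep_symm a) (T.indep_symm (indep_mono b subset_rfl ?_))
  intro C; simp only [Finset.mem_union]; tauto

variable (T) in
/-- A minimal pair that is not independent, and whose failure of independence is not already caused
by a non-constant attribute determined by both sides. -/
structure Critical (X Y : Finset β) : Prop where
  minimal : Minimal (fun p : Finset β × Finset β => ¬ T.indep p.1 p.2) (X, Y)
  closure_inter : ∀ C ∈ T.closure X, C ∈ T.closure Y → T.const C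

namespace Critical

variable {X Y : Finset β} (h : T.Critical X Y)
include h

theorem indep_of_subset {X' Y' : Finset β} (hX : X' ⊆ X) (hY : Y' ⊆ Y)
    (hne : ¬ (X ⊆ X' ∧ Y ⊆ Y')) : T.indep X' Y' := by
  by_contra hI
  exact hne (h.minimal.2 (y := (X', Y')) hI ⟨hX, hY⟩)

theorem not_indep : ¬ T.indep X Y := h.minimal.1

theorem not_const_left {A : β} (hA : A ∈ X) : ¬ T.const A := by
  intro hc
  have : T.indep (X.erase A) Y := h.indep_of_subset (Finset.erase_subset _ _) subset_rfl
    fun h' => by simpa using h'.1 hA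
  refine h.not_indep (indep_closure this (fun C hC => ?_) fun C hC => Or.inr ⟨C, hC, T.det_refl C⟩)
  by_cases hCA : C = A
  · exact Or.inl (hCA ▸ hc)
  · exact Or.inr ⟨C, Finset.mem_erase.2 ⟨hCA, hC⟩, T.det_refl C⟩

theorem symm : T.Critical Y X := by
  refine ⟨⟨fun hI => h.not_indep (T.indep_symm hI), ?_⟩, fun C h1 h2 => h.closure_inter C h2 h1⟩
  rintro ⟨a, b⟩ hab hle
  have := h.minimal.2 (y := (b, a)) (fun hI => hab (T.indep_symm hI)) ⟨hle.2, hle.1⟩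
  exact ⟨this.2, this.1⟩

theorem not_const {A : β} (hA : A ∈ X ∪ Y) : ¬ T.const A := by
  rcases Finset.mem_union.1 hA with hA | hA
  · exact h.not_const_left hA
  · exact h.symm.not_const_left hA

theorem disjoint : Disjoint X Y := by
  rw [Finset.disjoint_left]
  intro A hX hY
  exact h.not_const_left hX (h.closure_inter A (.inr ⟨A, hX, T.det_refl A⟩)
    (.inr ⟨A, hY, T.det_refl A⟩))

theorem nonempty_left : X.Nonempty := by
  rw [Finset.nonempty_iff_ne_empty]
  rintro rfl
  exact h.not_indep (T.indep_empty Y)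

/-- If `X ∪ Y` is covered by the closures of two independent sets, then it lies inside one of
them. Otherwise, the parts of `X` and `Y` inside the two closures are smaller pairs, hence
independent, and glue to `X ⊥ Y`. -/
theorem subset_closure {X' Y' : Finset β} (hI : T.indep X' Y')
    (hsub : ∀ C ∈ X ∪ Y, C ∈ T.closure X' ∨ C ∈ T.closure Y') :
    (∀ C ∈ X ∪ Y, C ∈ T.closure X') ∨ (∀ C ∈ X ∪ Y, C ∈ T.closure Y') := by
  classical
  by_contra! hcon
  obtain ⟨⟨C, hC, hC'⟩, D, hD, hD'⟩ := hcon
  have h₁ : T.indep (X.filter (· ∈ T.closure X')) (Y.filter (· ∈ T.closure X')) := by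
    refine h.indep_of_subset (Finset.filter_subset _ _) (Finset.filter_subset _ _) fun h' => ?_
    rcases Finset.mem_union.1 hC with hC | hC
    · exact hC' (Finset.mem_filter.1 (h'.1 hC)).2
    · exact hC' (Finset.mem_filter.1 (h'.2 hC)).2
  have hout : ∀ {E}, E ∈ X ∪ Y → E ∉ T.closure X' → E ∈ T.closure Y' := fun hE hE' =>
    (hsub _ hE).resolve_left hE'
  have h₂ : T.indep (X.filter (· ∉ T.closure X')) (Y.filter (· ∉ T.closure X')) := by
    have hDX : D ∈ T.closure X' := (hsub D hD).resolve_right hD'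
    refine h.indep_of_subset (Finset.filter_subset _ _) (Finset.filter_subset _ _) fun h' => ?_
    rcases Finset.mem_union.1 hD with hD | hD
    · exact (Finset.mem_filter.1 (h'.1 hD)).2 hDX
    · exact (Finset.mem_filter.1 (h'.2 hD)).2 hDX
  have h₃ := indep_glue h₁ h₂ (indep_closure hI ?_ ?_)
  · rw [Finset.filter_union_filter_not_eq, Finset.filter_union_filter_not_eq] at h₃
    exact h.not_indep h₃
  · rw [← Finset.filter_union]
    exact fun C hC => (Finset.mem_filter.1 hC).2
  · rw [← Finset.filter_union]
    exact fun C hC => hout (Finset.mem_filter.1 hC).1 (Finset.mem_filter.1 hC).2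

end Critical

/-- The two causes for a failure of independence: a non-constant attribute determined by both
sides, or a critical pair inside. -/
theorem exists_critical {X Y : Finset β} (h : ¬ T.indep X Y) :
    (∃ C, C ∈ T.closure X ∧ C ∈ T.closure Y ∧ ¬ T.const C) ∨
      ∃ X' ⊆ X, ∃ Y' ⊆ Y, T.Critical X' Y' := by
  by_cases hc : ∃ C, C ∈ T.closure X ∧ C ∈ T.closure Y ∧ ¬ T.const C
  · exact Or.inl hc
  · push Not at hc
    obtain ⟨⟨X', Y'⟩, hle, hmin⟩ := exists_minimal_le_of_wellFoundedLT
      (fun p : Finset β × Finset β => ¬ T.indep p.1 p.2) (X, Y) h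
    have mono : ∀ {Z W : Finset β}, Z ⊆ W → T.closure Z ⊆ T.closure W := by
      rintro Z W hZW C (hC | ⟨A, hA, hAC⟩)
      exacts [Or.inl hC, Or.inr ⟨A, hZW hA, hAC⟩]
    exact Or.inr ⟨X', hle.1, Y', hle.2, hmin,
      fun C h1 h2 => hc C (mono hle.1 h1) (mono hle.2 h2)⟩

end Independence

end ClosedTheory

/-! ### Column sizes -/

section Weights

variable {β : Type*} [Fintype β]

/-- The number of bits in a column of rank `k`; constants show no bits. -/
def height (M k : ℕ) : ℕ := if k = 0 then 0 else M ^ k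

theorem height_add_le {M n : ℕ} (hM : n + 1 ≤ M) {k l : ℕ} (h : k < l) :
    height M k + n ≤ height M l := by
  obtain ⟨l, rfl⟩ : ∃ j, l = j + 1 := ⟨l - 1, by omega⟩
  have hl : height M (l + 1) = M ^ l * M := by simp [height, pow_succ]
  have hk : height M k ≤ M ^ l := by
    unfold height
    split_ifs
    · exact Nat.zero_le _
    · exact Nat.pow_le_pow_right (by omega) (by omega)
  have h1 : 1 ≤ M ^ l := Nat.one_le_pow _ _ (by omega)
  rw [hl]
  nlinarith

open Classical in
/-- Numbers of free bits by recursion on the rank: the representative `rep C` of each class of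
equivalent attributes carries what is missing to the total `g C` after the bits of lower rank, and
the other attributes carry none. -/
noncomputable def weight (det : β → β → Prop) (rep : β → β) (g ρ : β → ℕ) (C : β) : ℕ :=
  if rep C = C then
    g C - ∑ D, if _h : det C D ∧ ρ D < ρ C then weight det rep g ρ D else 0
  else 0
termination_by ρ C
decreasing_by exact _h.2

/-- A choice of representatives for the equivalence relation of a preorder. -/
theorem exists_representative {γ : Type*} {r : γ → γ → Prop} (hrefl : ∀ a, r a a)
    (htrans : ∀ {a b c}, r a b → r b c → r a c) :
    ∃ f : γ → γ, (∀ a, r a (f a) ∧ r (f a) a) ∧ ∀ a b, r a b → r b a → f a = f b := by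
  let s : Setoid γ := ⟨fun a b => r a b ∧ r b a, fun a => ⟨hrefl a, hrefl a⟩,
    fun h => ⟨h.2, h.1⟩, fun h h' => ⟨htrans h.1 h'.1, htrans h'.2 h.2⟩⟩
  refine ⟨fun a => (Quotient.mk s a).out, fun a => ?_, fun a b h h' => ?_⟩
  · have := Quotient.mk_out (s := s) a
    exact ⟨this.2, this.1⟩
  · exact congrArg Quotient.out (Quotient.sound (s := s) ⟨h, h'⟩)

open Classical in
/-- If column `A` already shows `c A` bits, then free bits can be added to fill each column up to
the height that belongs to its rank, with at least one free bit in every class of non-constant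
attributes. -/
theorem exists_weight {det : β → β → Prop} (hrefl : ∀ A, det A A)
    (htrans : ∀ {A B C}, det A B → det B C → det A C) {ρ c : β → ℕ}
    (hρ : ∀ A B, det A B → ρ B ≤ ρ A ∧ (ρ A = ρ B → det B A))
    (hc : ∀ A B, det A B → det B A → c A = c B) (hc0 : ∀ A, ρ A = 0 → c A = 0)
    {m M : ℕ} (hm : ∀ A, c A ≤ m) (hM : Fintype.card β + m + 1 ≤ M) :
    ∃ w : β → ℕ, (∀ A, c A + ∑ C with det A C, w C = height M (ρ A)) ∧
      ∀ A, ρ A ≠ 0 → ∃ C, det A C ∧ det C A ∧ 0 < w C := by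
  obtain ⟨rep, hrep, hrep'⟩ := exists_representative hrefl htrans
  let g : β → ℕ := fun A => height M (ρ A) - c A
  let w := weight det rep g ρ
  let low : β → ℕ := fun A => ∑ D with det A D ∧ ρ D < ρ A, w D
  have hw : ∀ C, w C = if rep C = C then g C - low C else 0 := by
    intro C
    simp only [w, low]
    rw [weight]
    simp only [Finset.sum_filter, dite_eq_ite]
  have hwle : ∀ C, w C ≤ height M (ρ C) := by
    intro C
    rw [hw]
    split_ifs
    · exact (Nat.sub_le _ _).trans (Nat.sub_le _ _)
    · exact Nat.zero_le _
  have hlow : ∀ A, ρ A ≠ 0 → low A + c A < height M (ρ A) := by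
    intro A hA
    obtain ⟨k, hk⟩ := Nat.exists_eq_succ_of_ne_zero hA
    have h1 : low A ≤ Fintype.card β * M ^ k := by
      refine (Finset.sum_le_card_nsmul _ _ (M ^ k) fun D hD => ?_).trans ?_
      · have := (Finset.mem_filter.1 hD).2.2
        refine (hwle D).trans ?_
        unfold height
        split_ifs
        · exact Nat.zero_le _
        · exact Nat.pow_le_pow_right (by omega) (by omega)
      · exact Nat.mul_le_mul_right _ (Finset.card_le_univ _)
    have h2 : height M (ρ A) = M ^ k * M := by simp [height, hk, pow_succ]
    have h3 : 1 ≤ M ^ k := Nat.one_le_pow _ _ (by omega)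
    have h4 := hm A
    rw [h2]
    nlinarith
  have hρeq : ∀ A B, det A B → det B A → ρ A = ρ B := fun A B h h' =>
    le_antisymm (hρ B A h').1 (hρ A B h).1
  have hreprep : ∀ A, rep (rep A) = rep A := fun A =>
    (hrep' _ _ (hrep A).1 (hrep A).2).symm
  have hwrep : ∀ A, w (rep A) = g A - low A := by
    intro A
    obtain ⟨h1, h2⟩ := hrep A
    rw [hw, if_pos (hreprep A)]
    congr 1
    · simp only [g, hρeq _ _ h1 h2, hc _ _ h1 h2]
    · refine Finset.sum_congr (Finset.filter_congr fun D _ => ?_) fun _ _ => rfl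
      rw [hρeq _ _ h1 h2]
      exact and_congr_left fun _ => ⟨htrans h1, htrans h2⟩
  have hlow0 : ∀ A, ρ A = 0 → low A = 0 := by
    intro A hA
    simp [low, hA]
  refine ⟨w, fun A => ?_, fun A hA => ⟨rep A, (hrep A).1, (hrep A).2, ?_⟩⟩
  · have hsplit : ∑ C with det A C, w C = low A + w (rep A) := by
      rw [← Finset.sum_filter_add_sum_filter_not _ (fun C => ρ C < ρ A), Finset.filter_filter,
        Finset.filter_filter]
      congr 1
      refine Finset.sum_eq_single_of_mem _ ?_ ?_
      · simp [(hrep A).1, hρeq _ _ (hrep A).1 (hrep A).2]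
      · intro D hD hne
        obtain ⟨h1, h2⟩ := (Finset.mem_filter.1 hD).2
        have h3 := hρ A D h1
        have h4 := hrep' A D h1 (h3.2 (by omega))
        rw [hw, if_neg fun h => hne (by rw [h4, h])]
    rw [hsplit, hwrep]
    by_cases hA : ρ A = 0
    · simp [hlow0 A hA, hc0 A hA, g, hA, height]
    · have := hlow A hA
      simp only [g]
      omega
  · rw [hwrep]
    have := hlow A hA
    simp only [g]
    omega

open Classical in
/-- A preorder is the inclusion order of finite sets of prescribed sizes, if sizes grow by at least
`Fintype.card β` along strict relations, and only minimal elements have a set smaller than that. -/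
theorem exists_nested_finsets {sub : β → β → Prop} (hrefl : ∀ A, sub A A)
    (htrans : ∀ {A B C}, sub A B → sub B C → sub A C) {N : β → ℕ}
    (hN : ∀ A B, sub A B → N A + Fintype.card β ≤ N B ∨ (N A = N B ∧ sub B A))
    (hN' : ∀ A, Fintype.card β ≤ N A ∨ (1 ≤ N A ∧ ∀ B, sub B A → sub A B)) :
    ∃ S : β → Finset (Finset β ⊕ ℕ), (∀ A, (S A).card = N A) ∧
      ∀ A B, S A ⊆ S B ↔ sub A B := by
  -- The set of `A` holds a marker `up E` for each `E` below `A`, shared by equivalent elements,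
  -- and is padded with an initial segment of `ℕ` up to its size.
  let up : β → Finset β := fun A => Finset.univ.filter (sub A)
  let mk : β → Finset (Finset β) := fun A => (Finset.univ.filter (sub · A)).image up
  have hmk : ∀ {A B}, sub A B → mk A ⊆ mk B := by
    intro A B h
    refine Finset.image_subset_image fun C hC => ?_
    simp only [Finset.mem_filter, Finset.mem_univ, true_and] at hC ⊢
    exact htrans hC h
  have hcard : ∀ A, (mk A).card ≤ Fintype.card β := fun A =>
    Finset.card_image_le.trans (Finset.card_le_univ _)
  have hcardN : ∀ A, (mk A).card ≤ N A := by
    intro A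
    rcases hN' A with h | ⟨h1, h⟩
    · exact (hcard A).trans h
    · refine le_trans (Finset.card_le_one.2 ?_) h1
      have key : ∀ a ∈ mk A, a = up A := by
        intro a ha
        obtain ⟨B, hB, rfl⟩ := Finset.mem_image.1 ha
        have hB : sub B A := (Finset.mem_filter.1 hB).2
        ext C
        simp only [up, Finset.mem_filter, Finset.mem_univ, true_and]
        exact ⟨htrans (h B hB), htrans hB⟩
      intro a ha b hb
      rw [key a ha, key b hb]
  refine ⟨fun A => (mk A).disjSum (Finset.range (N A - (mk A).card)), fun A => ?_, fun A B => ?_⟩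
  · rw [Finset.card_disjSum, Finset.card_range]
    have := hcardN A
    omega
  · constructor
    · intro h
      have h1 : Sum.inl (up A) ∈ (mk A).disjSum (Finset.range (N A - (mk A).card)) :=
        Finset.inl_mem_disjSum.2 (Finset.mem_image.2 ⟨A, by simp [hrefl], rfl⟩)
      obtain ⟨E, hE, hEA⟩ := Finset.mem_image.1 (Finset.inl_mem_disjSum.1 (h h1))
      have hE : sub E B := (Finset.mem_filter.1 hE).2
      have : B ∈ up A := by rw [← hEA]; simpa [up] using hE
      simpa [up] using this
    · intro h
      refine Finset.disjSum_mono (hmk h) (Finset.range_subset_range.2 ?_)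
      have h1 := hcard B
      rcases hN A B h with h2 | ⟨h2, h3⟩
      · omega
      · rw [h2, (hmk h).antisymm (hmk h3)]

end Weights

/-! ### Linear algebra over the two-element field -/

theorem exists_ncard_range_eq_two_pow {V W : Type*} [AddCommGroup V] [AddCommGroup W]
    [Module (ZMod 2) V] [Module (ZMod 2) W] [Finite V] (f : V →ₗ[ZMod 2] W) :
    ∃ c, (Set.range f).ncard = 2 ^ c := by
  have : Finite (LinearMap.range f) := Set.finite_range f
  have := Fintype.ofFinite (LinearMap.range f)
  refine ⟨Module.finrank (ZMod 2) (LinearMap.range f), ?_⟩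
  have h := Module.card_eq_pow_finrank (K := ZMod 2) (V := LinearMap.range f)
  rw [ZMod.card, ← Nat.card_eq_fintype_card] at h
  rw [← h, ← Nat.card_coe_set_eq]
  rfl

/-- Values prescribed on two disjoint sets extend to a function of sum zero on `Z`: a point of
`Z` outside both sets can be used for correction, and otherwise `Z` lies inside one of them. -/
theorem exists_even_extension {β : Type*} [DecidableEq β] {Z : Finset β} {D₁ D₂ : Set β}
    (hD : Disjoint D₁ D₂)
    (hZ : (∀ C ∈ Z, C ∈ D₁ ∨ C ∈ D₂) → (∀ C ∈ Z, C ∈ D₁) ∨ ∀ C ∈ Z, C ∈ D₂)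
    {f g : β → ZMod 2} (hf : ∑ C ∈ Z, f C = 0) (hg : ∑ C ∈ Z, g C = 0) :
    ∃ h : β → ZMod 2, ∑ C ∈ Z, h C = 0 ∧ (∀ C ∈ D₁, h C = f C) ∧ ∀ C ∈ D₂, h C = g C := by
  classical
  let h₀ : β → ZMod 2 := fun C => if C ∈ D₁ then f C else g C
  have h1 : ∀ C ∈ D₁, h₀ C = f C := fun C hC => if_pos hC
  have h2 : ∀ C ∈ D₂, h₀ C = g C := fun C hC => if_neg (Set.disjoint_right.1 hD hC)
  by_cases hcov : ∀ C ∈ Z, C ∈ D₁ ∨ C ∈ D₂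
  · refine ⟨h₀, ?_, h1, h2⟩
    rcases hZ hcov with h | h
    · rw [← hf]; exact Finset.sum_congr rfl fun C hC => h1 C (h C hC)
    · rw [← hg]; exact Finset.sum_congr rfl fun C hC => h2 C (h C hC)
  · push Not at hcov
    obtain ⟨z, hz, hz1, hz2⟩ := hcov
    refine ⟨Function.update h₀ z (-∑ C ∈ Z.erase z, h₀ C), ?_, fun C hC => ?_, fun C hC => ?_⟩
    · rw [← Finset.add_sum_erase _ _ hz, Function.update_self,
        Finset.sum_congr rfl fun C hC => Function.update_of_ne (Finset.ne_of_mem_erase hC) _ _]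
      ring
    · rw [Function.update_of_ne (by rintro rfl; exact hz1 hC), h1 C hC]
    · rw [Function.update_of_ne (by rintro rfl; exact hz2 hC), h2 C hC]

/-- The values of a function can be renamed onto any set with the right number of elements. -/
theorem exists_relabelling {Ω W V : Type*} [Finite Ω] (f : Ω → W) (S : Finset V)
    (h : (Set.range f).ncard = S.card) :
    ∃ g : Ω → V, Set.range g = S ∧ ∀ x y, g x = g y ↔ f x = f y := by
  have : Finite (Set.range f) := Set.finite_range f
  have e : Set.range f ≃ S := 
    have := Fintype.ofFinite (Set.range f)
    Fintype.equivOfCardEq (by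
      rw [← Nat.card_eq_fintype_card, Nat.card_coe_set_eq, h, Fintype.card_coe])
  refine ⟨fun x => e (Set.rangeFactorization f x), ?_, fun x y => ?_⟩
  · ext v
    constructor
    · rintro ⟨x, rfl⟩
      exact (e _).2
    · intro hv
      obtain ⟨⟨_, x, rfl⟩, hx⟩ := e.surjective ⟨v, hv⟩
      exact ⟨x, congrArg Subtype.val hx⟩
  · rw [Subtype.coe_inj, e.apply_eq_iff_eq, Subtype.ext_iff]
    rfl

/-! ### A relation realizing a closed theory -/

namespace ClosedTheory

universe u
variable {β : Type u} [DecidableEq β] (T : ClosedTheory β)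

open Classical in
/-- The attributes whose bits for the index `i` must have an even sum. -/
noncomputable def paritySet (i : Finset β × Finset β) : Finset β :=
  if T.Critical i.1 i.2 then i.1 ∪ i.2 else ∅

/-- The bit vectors, with one bit per attribute for every index, that satisfy all parity
constraints. -/
def evenSpace : Submodule (ZMod 2) ((Finset β × Finset β) × β → ZMod 2) where
  carrier := {b | ∀ i, ∑ C ∈ T.paritySet i, b (i, C) = 0}
  add_mem' := by
    intro a b ha hb i
    simp only [Pi.add_apply, Finset.sum_add_distrib, ha i, hb i, add_zero]
  zero_mem' := by simp
  smul_mem' := by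
    intro c b hb i
    simp only [Pi.smul_apply, ← Finset.smul_sum, hb i, smul_zero]

/-- A tuple before the naming of values: a constrained bit vector and `w C` free bits for each
attribute `C`. -/
abbrev BitTuple (w : β → ℕ) : Type u := T.evenSpace × ((Σ C, Fin (w C)) → ZMod 2)

/-- The tuples `x` and `y` agree on `A`: they have the same bits at all non-constant attributes
that `A` determines. For the free bits, non-constancy is left to the choice of `w`
(`Admissible.const`). -/
def Agree {w : β → ℕ} (A : β) (x y : T.BitTuple w) : Prop :=
  (∀ i C, T.det A C → ¬ T.const C → x.1.1 (i, C) = y.1.1 (i, C)) ∧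
    ∀ j, T.det A j.1 → x.2 j = y.2 j

/-- Constants carry no free bits, and each class of equivalent non-constant attributes
carries at least one. -/
structure Admissible (w : β → ℕ) : Prop where
  const : ∀ A, T.const A → w A = 0
  pos : ∀ A, ¬ T.const A → ∃ C, T.det A C ∧ T.det C A ∧ 0 < w C

section

variable {T} {w : β → ℕ} (hw : T.Admissible w)
include hw

theorem agree_of_const {A : β} (h : T.const A) (x y : T.BitTuple w) : T.Agree A x y := by
  refine ⟨fun i C hC hC' => absurd (T.const_of_det h hC) hC', fun ⟨C, k⟩ hC => ?_⟩
  have := hw.const C (T.const_of_det h hC)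
  exact absurd k.2 (by omega)

theorem const_of_agree {A : β} (h : ∀ x y : T.BitTuple w, T.Agree A x y) : T.const A := by
  classical
  by_contra hA
  obtain ⟨C, hC, -, hpos⟩ := hw.pos A hA
  have := (h (0, Pi.single ⟨C, ⟨0, hpos⟩⟩ 1) (0, 0)).2 ⟨C, ⟨0, hpos⟩⟩ hC
  simp at this

omit hw in
theorem Agree.of_det {A B : β} {x y : T.BitTuple w} (h : T.Agree A x y) (hAB : T.det A B) :
    T.Agree B x y :=
  ⟨fun i C hC => h.1 i C (T.det_trans hAB hC), fun j hj => h.2 j (T.det_trans hAB hj)⟩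

theorem det_of_agree {A B : β} (h : ∀ x y : T.BitTuple w, T.Agree A x y → T.Agree B x y) :
    T.det A B := by
  classical
  by_cases hB : T.const B
  · exact T.det_of_const hB
  obtain ⟨C, hC, hC', hpos⟩ := hw.pos B hB
  by_contra hAB
  have hAC : ¬ T.det A C := fun h => hAB (T.det_trans h hC')
  have := (h (0, Pi.single ⟨C, ⟨0, hpos⟩⟩ 1) (0, 0) ⟨fun _ _ _ _ => rfl, fun j hj => ?_⟩).2
    ⟨C, ⟨0, hpos⟩⟩ hC
  · simp at this
  · exact Pi.single_eq_of_ne (by rintro rfl; exact hAC hj) _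

theorem exists_agree_of_indep {X Y : Finset β} (h : T.indep X Y) (x y : T.BitTuple w) :
    ∃ z, (∀ A ∈ X, T.Agree A z x) ∧ ∀ A ∈ Y, T.Agree A z y := by
  classical
  have hbit : ∀ i, ∃ f : β → ZMod 2, ∑ C ∈ T.paritySet i, f C = 0 ∧
      (∀ C ∈ {C | C ∈ T.closure X ∧ ¬ T.const C}, f C = x.1.1 (i, C)) ∧
      ∀ C ∈ {C | C ∈ T.closure Y ∧ ¬ T.const C}, f C = y.1.1 (i, C) := by
    intro i
    refine exists_even_extension ?_ ?_ (x.1.2 i) (y.1.2 i)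
    · exact Set.disjoint_left.2 fun C h1 h2 => h1.2 (const_of_mem_closure h h1.1 h2.1)
    · intro hcov
      unfold paritySet at hcov ⊢
      split_ifs at hcov ⊢ with hi
      · refine (hi.subset_closure h fun C hC => (hcov C hC).imp (·.1) (·.1)).imp ?_ ?_ <;>
        exact fun h' C hC => ⟨h' C hC, hi.not_const hC⟩
      · simp
  choose f hf0 hfX hfY using hbit
  refine ⟨(⟨fun p => f p.1 p.2, hf0⟩, fun j => if j.1 ∈ T.closure X then x.2 j else y.2 j),
    fun A hA => ⟨fun i C hC hC' => hfX i C ⟨Or.inr ⟨A, hA, hC⟩, hC'⟩, fun j hj => ?_⟩,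
    fun A hA => ⟨fun i C hC hC' => hfY i C ⟨Or.inr ⟨A, hA, hC⟩, hC'⟩, fun j hj => ?_⟩⟩
  · exact if_pos (Or.inr ⟨A, hA, hj⟩)
  · refine if_neg fun hX => ?_
    have := hw.const j.1 (const_of_mem_closure h hX (Or.inr ⟨A, hA, hj⟩))
    exact absurd j.2.2 (by omega)

theorem indep_of_agree {X Y : Finset β}
    (h : ∀ x y : T.BitTuple w, ∃ z, (∀ A ∈ X, T.Agree A z x) ∧ ∀ A ∈ Y, T.Agree A z y) :
    T.indep X Y := by
  classical
  by_contra hI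
  rcases exists_critical hI with ⟨C, hX, hY, hC⟩ | ⟨X', hX', Y', hY', hcrit⟩
  · obtain ⟨A, hA, hAC⟩ := hX.resolve_left hC
    obtain ⟨B, hB, hBC⟩ := hY.resolve_left hC
    obtain ⟨E, hCE, -, hpos⟩ := hw.pos C hC
    obtain ⟨z, hz, hz'⟩ := h (0, 0) (0, Pi.single ⟨E, ⟨0, hpos⟩⟩ 1)
    have h1 := (hz A hA).2 ⟨E, ⟨0, hpos⟩⟩ (T.det_trans hAC hCE)
    have h2 := (hz' B hB).2 ⟨E, ⟨0, hpos⟩⟩ (T.det_trans hBC hCE)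
    rw [h1] at h2
    simp at h2
  · -- The zero tuple and the tuple with ones at `a` and `b` cannot be combined: the result would
    -- have a single one on `X' ∪ Y'`.
    obtain ⟨a, ha⟩ := hcrit.nonempty_left
    obtain ⟨b, hb⟩ := hcrit.symm.nonempty_left
    have hpar : T.paritySet (X', Y') = X' ∪ Y' := if_pos hcrit
    let v : (Finset β × Finset β) × β → ZMod 2 := fun p =>
      if p.1 = (X', Y') then (Pi.single a 1 : β → ZMod 2) p.2 + (Pi.single b 1 : β → ZMod 2) p.2
      else 0
    have hv : v ∈ T.evenSpace := by
      intro i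
      by_cases hi : i = (X', Y')
      · subst hi
        simp only [v, if_true, Finset.sum_add_distrib, hpar]
        rw [Finset.sum_pi_single', Finset.sum_pi_single',
          if_pos (Finset.mem_union_left _ ha), if_pos (Finset.mem_union_right _ hb)]
        rfl
      · simp [v, hi]
    obtain ⟨z, hz, hz'⟩ := h (0, 0) (⟨v, hv⟩, 0)
    have h0 : ∑ C ∈ X' ∪ Y', z.1.1 ((X', Y'), C) = 0 := by
      have := z.1.2 (X', Y')
      rwa [hpar] at this
    rw [Finset.sum_union hcrit.disjoint] at h0
    have hXz : ∑ C ∈ X', z.1.1 ((X', Y'), C) = 0 := Finset.sum_eq_zero fun C hC =>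
      (hz C (hX' hC)).1 _ C (T.det_refl C) (hcrit.not_const_left hC)
    have hYz : ∑ C ∈ Y', z.1.1 ((X', Y'), C) = ∑ C ∈ Y', (Pi.single b 1 : β → ZMod 2) C := by
      refine Finset.sum_congr rfl fun C hC => ?_
      rw [(hz' C (hY' hC)).1 _ C (T.det_refl C) (hcrit.symm.not_const_left hC)]
      have hne : C ≠ a := by
        rintro rfl
        exact Finset.disjoint_left.1 hcrit.disjoint ha hC
      simp [v, hne]
    rw [hXz, hYz, Finset.sum_pi_single', if_pos hb] at h0
    simp at h0

end

open Classical in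
/-- Every closed theory over finitely many attributes is the theory of a finite relation, here given
as a family of tuples. -/
theorem exists_realization [Finite β] :
    ∃ (Ω : Type u) (_ : Finite Ω) (_ : Nonempty Ω) (t : Ω → β → Finset β ⊕ ℕ),
      (∀ A, (∀ x y, t x A = t y A) ↔ T.const A) ∧
      (∀ A B, (∀ x y, t x A = t y A → t x B = t y B) ↔ T.det A B) ∧
      (∀ A B, (∀ x, ∃ y, t x A = t y B) ↔ T.sub A B) ∧
      ∀ X Y, (∀ x y, ∃ z, (∀ A ∈ X, t z A = t x A) ∧ ∀ A ∈ Y, t z A = t y A) ↔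
        T.indep X Y := by
  have := Fintype.ofFinite β
  obtain ⟨ρ, hρ0, hρdet, hρsub⟩ := T.exists_rank
  -- The restriction of the constrained bits to the attributes in `D`. Its range is a vector space,
  -- so that the number of its values is a power of two.
  let restr (D : Set β) : T.evenSpace →ₗ[ZMod 2] ((Finset β × Finset β) × D → ZMod 2) :=
    (LinearMap.funLeft (ZMod 2) (ZMod 2) (Prod.map id Subtype.val)).comp T.evenSpace.subtype
  choose c hc using fun D => exists_ncard_range_eq_two_pow (restr D)
  let D : β → Set β := fun A => {C | T.det A C ∧ ¬ T.const C}
  let m := ∑ A, c (D A)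
  let M := Fintype.card β + m + 1
  obtain ⟨w, hwsum, hwpos⟩ := exists_weight (c := fun A => c (D A)) T.det_refl T.det_trans hρdet
    (fun A B h h' => by
      have : D A = D B := by
        ext C
        exact and_congr_left fun _ => ⟨T.det_trans h', T.det_trans h⟩
      rw [this])
    (fun A hA => by
      have hemp : IsEmpty (D A) :=
        ⟨fun C => C.2.2 (T.const_of_det ((hρ0 A).1 hA) C.2.1)⟩
      have h1 : (Set.range (restr (D A))).ncard ≤ 1 :=
        Set.ncard_le_one_of_subsingleton _
      rw [hc] at h1
      by_contra hne
      exact absurd h1 (not_le.2 (Nat.one_lt_two_pow hne)))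
    (m := m) (fun A => Finset.single_le_sum (f := fun A => c (D A)) (fun _ _ => Nat.zero_le _)
      (Finset.mem_univ A)) (M := M) le_rfl
  have hw : T.Admissible w := by
    refine ⟨fun A hA => ?_, fun A hA => hwpos A (mt (hρ0 A).1 hA)⟩
    have h1 := hwsum A
    have h2 : w A ≤ ∑ C with T.det A C, w C :=
      Finset.single_le_sum (f := w) (fun _ _ => Nat.zero_le _) (by simp [T.det_refl])
    simp only [(hρ0 A).2 hA, height, if_true] at h1
    omega
  have hgap : ∀ {A B}, ρ A < ρ B →
      2 ^ height M (ρ A) + Fintype.card β ≤ 2 ^ height M (ρ B) := by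
    intro A B h
    have h1 := height_add_le (M := M) (n := Fintype.card β) (by omega) h
    have h2 : 1 ≤ 2 ^ height M (ρ A) := Nat.one_le_two_pow
    have h3 : Fintype.card β < 2 ^ Fintype.card β := Nat.lt_two_pow_self
    calc 2 ^ height M (ρ A) + Fintype.card β
        ≤ 2 ^ height M (ρ A) * 2 ^ Fintype.card β := by nlinarith
      _ = 2 ^ (height M (ρ A) + Fintype.card β) := (pow_add _ _ _).symm
      _ ≤ _ := Nat.pow_le_pow_right (by norm_num) h1
  obtain ⟨S, hScard, hSsub⟩ := exists_nested_finsets T.sub_refl T.sub_trans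
    (N := fun A => 2 ^ height M (ρ A))
    (fun A B h => by
      rcases (hρsub A B h).1.lt_or_eq with h' | h'
      · exact Or.inl (hgap h')
      · exact Or.inr ⟨by rw [h'], (hρsub A B h).2 h'⟩)
    (fun A => by
      by_cases hA : ρ A = 0
      · refine Or.inr ⟨Nat.one_le_two_pow, fun B hBA => (hρsub B A hBA).2 ?_⟩
        have := (hρsub B A hBA).1
        omega
      · have h1 := height_add_le (M := M) (n := Fintype.card β) (by omega) (Nat.pos_of_ne_zero hA)
        exact Or.inl ((by omega : Fintype.card β ≤ height M (ρ A)).trans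
          Nat.lt_two_pow_self.le))
  -- The column of `A` before renaming.
  let f (A : β) : T.BitTuple w →
      ((Finset β × Finset β) × D A → ZMod 2) × ({j : Σ C, Fin (w C) // T.det A j.1} → ZMod 2) :=
    Prod.map (restr (D A)) (fun d j => d j.1)
  have hf : ∀ A x y, f A x = f A y ↔ T.Agree A x y := by
    intro A x y
    simp only [f, Prod.map, Prod.mk.injEq, Agree]
    refine and_congr ?_ ?_
    · rw [funext_iff]
      exact ⟨fun h i C hC hC' => h (i, ⟨C, hC, hC'⟩), fun h p => h p.1 p.2 p.2.2.1 p.2.2.2⟩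
    · rw [funext_iff]
      exact ⟨fun h j hj => h ⟨j, hj⟩, fun h j => h j j.2⟩
  have hrange : ∀ A, (Set.range (f A)).ncard = (S A).card := by
    intro A
    have hsurj : Set.range (fun (d : (Σ C, Fin (w C)) → ZMod 2)
        (j : {j : Σ C, Fin (w C) // T.det A j.1}) => d j.1) = Set.univ := by
      refine Set.range_eq_univ.2 fun g => ⟨fun j => if h : T.det A j.1 then g ⟨j, h⟩ else 0, ?_⟩
      ext j
      simp [j.2]
    have hcard : Fintype.card {j : Σ C, Fin (w C) // T.det A j.1} = ∑ C with T.det A C, w C := by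
      rw [Fintype.card_subtype]
      have : (Finset.univ.filter fun j : Σ C, Fin (w C) => T.det A j.1) =
          (Finset.univ.filter (T.det A)).sigma fun C => (Finset.univ : Finset (Fin (w C))) := by
        ext j; simp
      rw [this, Finset.card_sigma]
      simp
    simp only [f]
    rw [Set.range_prodMap, hsurj, Set.ncard_prod, hc, Set.ncard_univ, Nat.card_eq_fintype_card,
      Fintype.card_fun, ZMod.card, hcard, ← pow_add, hwsum, hScard]
  choose t ht ht' using fun A => exists_relabelling (f A) (S A) (hrange A)
  have hag : ∀ A x y, t A x = t A y ↔ T.Agree A x y := fun A x y => (ht' A x y).trans (hf A x y)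
  refine ⟨T.BitTuple w, inferInstance, inferInstance, fun x A => t A x, fun A => ?_, fun A B => ?_,
    fun A B => ?_, fun X Y => ?_⟩
  · simp only [hag]
    exact ⟨const_of_agree hw, agree_of_const hw⟩
  · simp only [hag]
    exact ⟨det_of_agree hw, fun h x y hx => hx.of_det h⟩
  · rw [← hSsub, ← Finset.coe_subset, ← ht, ← ht, Set.range_subset_iff]
    simp only [Set.mem_range, eq_comm]
  · simp only [hag]
    exact ⟨indep_of_agree hw, exists_agree_of_indep hw⟩

end ClosedTheory

/-! ### Soundness -/

section Soundness

variable {α V : Type*} {Dom : α → Set V}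

theorem sat_uind (r : Rel Dom) (A B : α) :
    r.Sat (.uind A B) ↔ ∀ t ∈ r.tuples, ∃ t' ∈ r.tuples, t A = t' B := by
  simp only [Dep.uind, Rel.Sat, Fin.forall_fin_one]
  rfl

theorem sat_of_aStar [DecidableEq α] {P : Set (Dep α)} {σ : Dep α} (h : AStar P σ) (r : Rel Dom)
    (hP : ∀ τ ∈ P, r.Sat τ) : r.Sat σ := by
  cases h with
  | trivialIndependence X => exact fun t _ t' ht' => ⟨t', ht', by simp, by simp⟩
  | symmetry X Y =>
    intro t ht t' ht'
    obtain ⟨s, hs, h1, h2⟩ := hP (.ia X Y) rfl t' ht' t ht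
    exact ⟨s, hs, h2, h1⟩
  | decomposition X Y Z =>
    intro t ht t' ht'
    obtain ⟨s, hs, h1, h2⟩ := hP (.ia X (Y ∪ Z)) rfl t ht t' ht'
    exact ⟨s, hs, h1, fun A hA => h2 A (Finset.mem_union_left _ hA)⟩
  | exchange X Y Z =>
    intro t ht t' ht'
    obtain ⟨s, hs, h1, h2⟩ := hP (.ia X Y) (Or.inl rfl) t ht t' ht'
    obtain ⟨u, hu, h3, h4⟩ := hP (.ia (X ∪ Y) Z) (Or.inr rfl) s hs t' ht'
    refine ⟨u, hu, fun A hA => ?_, fun A hA => ?_⟩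
    · rw [h3 A (Finset.mem_union_left _ hA), h1 A hA]
    · rcases Finset.mem_union.1 hA with hA | hA
      · rw [h3 A (Finset.mem_union_right _ hA), h2 A hA]
      · exact h4 A hA
  | reflexivity X Y => exact fun t _ t' _ h A hA => h A (Finset.mem_union_right _ hA)
  | transitivity X Y Z =>
    exact fun t ht t' ht' h => hP (.fd Y Z) (Or.inr rfl) t ht t' ht'
      (hP (.fd X Y) (Or.inl rfl) t ht t' ht' h)
  | constancy X Y =>
    intro t ht t' ht' _ A hA
    obtain ⟨s, hs, h1, h2⟩ := hP (.ia X Y) (Or.inl rfl) t ht t' ht'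
    rw [← h2 A hA]
    exact (hP (.fd X Y) (Or.inr rfl) s hs t ht h1 A hA).symm
  | composition X Y Z W =>
    intro t ht t' ht'
    obtain ⟨s, hs, h1, h2⟩ := hP (.ia X (Y ∪ Z)) (Or.inl rfl) t ht t' ht'
    refine ⟨s, hs, h1, fun A hA => ?_⟩
    rcases Finset.mem_union.1 hA with hA | hA
    · exact h2 A hA
    · exact hP (.fd Z W) (Or.inr rfl) s hs t' ht'
        (fun B hB => h2 B (Finset.mem_union_right _ hB)) A hA

theorem sat_of_indRules {P : Set (Dep α)} {σ : Dep α} (h : IndRules P σ) (r : Rel Dom)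
    (hP : ∀ τ ∈ P, r.Sat τ) : r.Sat σ := by
  cases h with
  | reflexivity n A => exact fun t ht => ⟨t, ht, fun _ => rfl⟩
  | transitivity n A B C =>
    intro t ht
    obtain ⟨s, hs, h1⟩ := hP (.ind n A B) (Or.inl rfl) t ht
    obtain ⟨u, hu, h2⟩ := hP (.ind n B C) (Or.inr rfl) s hs
    exact ⟨u, hu, fun i => (h1 i).trans (h2 i)⟩

/-- Around the cycle, columns do not grow, so they all have the same finite size. Hence the maps
given by the functional dependencies are injective and the inclusions of columns are equalities. -/
theorem sat_reversed_of_cycle {k : ℕ} {A B : Fin (k + 1) → α} (r : Rel Dom)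
    (hr : r.tuples.Finite) (hP : ∀ τ ∈ cyclePremises A B, r.Sat τ) (i : Fin (k + 1)) :
    r.Sat (.fd {B i} {A i}) ∧ r.Sat (.uind (B i) (A (i + 1))) := by
  let col : α → Set V := fun C => (fun t => t C) '' r.tuples
  have hcol : ∀ C, (col C).Finite := fun C => hr.image _
  have hfd : ∀ i, ∀ t ∈ r.tuples, ∀ t' ∈ r.tuples, t (A i) = t' (A i) → t (B i) = t' (B i) := by
    intro i t ht t' ht' h
    exact hP (.fd {A i} {B i}) (Or.inl ⟨i, rfl⟩) t ht t' ht' (by simpa using h) (B i) (by simp)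
  have hind : ∀ i, col (A (i + 1)) ⊆ col (B i) := by
    rintro i _ ⟨t, ht, rfl⟩
    obtain ⟨t', ht', h⟩ := (sat_uind r _ _).1 (hP _ (Or.inr ⟨i, rfl⟩)) t ht
    exact ⟨t', ht', h.symm⟩
  have hmap : ∀ i, ∃ f : V → V, ∀ t ∈ r.tuples, f (t (A i)) = t (B i) := by
    intro i
    classical
    refine ⟨fun v => if h : ∃ t ∈ r.tuples, t (A i) = v then h.choose (B i) else v,
      fun t ht => ?_⟩
    have h : ∃ t' ∈ r.tuples, t' (A i) = t (A i) := ⟨t, ht, rfl⟩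
    dsimp only
    rw [dif_pos h]
    exact hfd i _ h.choose_spec.1 t ht h.choose_spec.2
  choose f hf using hmap
  have himg : ∀ i, f i '' col (A i) = col (B i) := by
    intro i
    simp only [col, Set.image_image]
    exact Set.image_congr (hf i)
  have h1 : ∀ i, (col (B i)).ncard ≤ (col (A i)).ncard := fun i => by
    rw [← himg]; exact Set.ncard_image_le (hcol _)
  have h2 : ∀ i, (col (A (i + 1))).ncard ≤ (col (B i)).ncard := fun i =>
    Set.ncard_le_ncard (hind i) (hcol _)
  have hsum : ∑ i, (col (A (i + 1))).ncard = ∑ i, (col (A i)).ncard :=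
    Equiv.sum_comp (Equiv.addRight (1 : Fin (k + 1))) fun i => (col (A i)).ncard
  have heq := (Finset.sum_eq_sum_iff_of_le fun i _ => (h2 i).trans (h1 i)).1 hsum i
    (Finset.mem_univ i)
  constructor
  · have hinj : Set.InjOn (f i) (col (A i)) := by
      refine Set.injOn_of_ncard_image_eq ?_ (hcol _)
      rw [himg]
      have := h1 i; have := h2 i; omega
    intro t ht t' ht' h C hC
    rw [Finset.mem_singleton.1 hC]
    refine hinj ⟨t, ht, rfl⟩ ⟨t', ht', rfl⟩ ?_
    rw [hf i t ht, hf i t' ht']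
    exact h _ (Finset.mem_singleton_self _)
  · rw [sat_uind]
    intro t ht
    have : col (A (i + 1)) = col (B i) :=
      Set.eq_of_subset_of_ncard_le (hind i) (by have := h1 i; omega) (hcol _)
    obtain ⟨t', ht', h⟩ : t (B i) ∈ col (A (i + 1)) := this ▸ ⟨t, ht, rfl⟩
    exact ⟨t', ht', h.symm⟩

theorem sat_of_finRules [DecidableEq α] {P : Set (Dep α)} {σ : Dep α} (h : finRules P σ)
    (r : Rel Dom) (hr : r.tuples.Finite) (hP : ∀ τ ∈ P, r.Sat τ) : r.Sat σ := by
  rcases h with h | h | ⟨k, h⟩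
  · exact sat_of_aStar h r hP
  · exact sat_of_indRules h r hP
  · cases h with
    | fd A B i => exact (sat_reversed_of_cycle r hr hP i).1
    | ind A B i => exact (sat_reversed_of_cycle r hr hP i).2

theorem finImplies_of_mem_deduction [DecidableEq α] {Γ : Set (Dep α)} {l : List (Dep α)}
    (hl : IsDeduction finRules Γ l) {σ : Dep α} (hσ : σ ∈ l) : FinImplies Dom Γ σ := by
  intro r hr hΓ
  suffices H : ∀ (i : ℕ) (hi : i < l.length), r.Sat l[i] by
    obtain ⟨i, hi, rfl⟩ := List.mem_iff_getElem.1 hσ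
    exact H i hi
  intro i
  induction i using Nat.strong_induction_on with
  | _ i ih =>
    intro hi
    rcases hl i hi with h | ⟨P, hP, hmem⟩
    · exact hΓ _ h
    · refine sat_of_finRules hP r hr fun τ hτ => ?_
      obtain ⟨j, hj, rfl⟩ := List.mem_iff_getElem.1 (hmem τ hτ)
      rw [List.length_take] at hj
      rw [List.getElem_take]
      exact ih j (by omega) (by omega)

end Soundness

/-! ### Bounded deductions -/

section Deductions

variable {α : Type*} {𝓡 : Axiomatization α} {Γ : Set (Dep α)}

/-- A deduction may be continued by a list whose lines are justified by the deduction together with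
earlier lines of the list. -/
theorem IsDeduction.append {l₁ l₂ : List (Dep α)} (h₁ : IsDeduction 𝓡 Γ l₁)
    (h₂ : ∀ (i : ℕ) (hi : i < l₂.length),
      l₂[i] ∈ Γ ∨ ∃ P : Set (Dep α), 𝓡 P l₂[i] ∧ ∀ τ ∈ P, τ ∈ l₁ ∨ τ ∈ l₂.take i) :
    IsDeduction 𝓡 Γ (l₁ ++ l₂) := by
  intro i hi
  rcases Nat.lt_or_ge i l₁.length with h | h
  · rw [List.getElem_append_left h]
    refine (h₁ i h).imp_right fun ⟨P, hP, hmem⟩ => ⟨P, hP, fun τ hτ => ?_⟩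
    rw [List.take_append_of_le_length h.le]
    exact hmem τ hτ
  · rw [List.getElem_append_right h]
    refine (h₂ _ (by rw [List.length_append] at hi; omega)).imp_right
      fun ⟨P, hP, hmem⟩ => ⟨P, hP, fun τ hτ => ?_⟩
    rw [List.take_append, List.take_of_length_le h]
    exact List.mem_append.2 (hmem τ hτ)

variable (𝓡 Γ) in
/-- `τ` is a line of a deduction from `Γ` all lines of which have the property `Q`. -/
def Derivable (Q : Dep α → Prop) (τ : Dep α) : Prop :=
  ∃ l : List (Dep α), IsDeduction 𝓡 Γ l ∧ (∀ ρ ∈ l, Q ρ) ∧ τ ∈ l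

namespace Derivable

variable {Q : Dep α → Prop}

theorem of_mem {τ : Dep α} (hτ : τ ∈ Γ) (hQ : Q τ) : Derivable 𝓡 Γ Q τ :=
  ⟨[τ], fun i hi => Or.inl (by simpa [List.getElem_singleton] using hτ), by simpa using hQ,
    by simp⟩

theorem exists_common {P : Set (Dep α)} (hP : P.Finite) (h : ∀ τ ∈ P, Derivable 𝓡 Γ Q τ) :
    ∃ l : List (Dep α), IsDeduction 𝓡 Γ l ∧ (∀ ρ ∈ l, Q ρ) ∧ ∀ τ ∈ P, τ ∈ l := by
  induction P, hP using Set.Finite.induction_on with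
  | empty => exact ⟨[], fun i hi => by simp at hi, by simp, by simp⟩
  | @insert τ P _ _ ih =>
    obtain ⟨l, hl, hlQ, hlP⟩ := ih fun ρ hρ => h ρ (Set.mem_insert_of_mem _ hρ)
    obtain ⟨l', hl', hlQ', hτ⟩ := h τ (Set.mem_insert _ _)
    refine ⟨l ++ l', hl.append fun i hi => (hl' i hi).imp_right fun ⟨P, hP, hmem⟩ =>
      ⟨P, hP, fun τ hτ => Or.inr (hmem τ hτ)⟩, fun ρ hρ => ?_, fun ρ hρ => ?_⟩
    · exact (List.mem_append.1 hρ).elim (hlQ ρ) (hlQ' ρ)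
    · rcases hρ with rfl | hρ
      · exact List.mem_append_right _ hτ
      · exact List.mem_append_left _ (hlP ρ hρ)

theorem of_rule {P : Set (Dep α)} {τ : Dep α} (hr : 𝓡 P τ) (hQ : Q τ) (hP : P.Finite)
    (h : ∀ ρ ∈ P, Derivable 𝓡 Γ Q ρ) : Derivable 𝓡 Γ Q τ := by
  obtain ⟨l, hl, hlQ, hlP⟩ := exists_common hP h
  refine ⟨l ++ [τ], hl.append fun i hi => Or.inr ⟨P, ?_, fun ρ hρ => Or.inl (hlP ρ hρ)⟩,
    fun ρ hρ => ?_, by simp⟩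
  · simpa [List.getElem_singleton] using hr
  · rcases List.mem_append.1 hρ with hρ | hρ
    · exact hlQ ρ hρ
    · rwa [List.mem_singleton.1 hρ]

/-- A deduction in which `τ` occurs can be prolonged by a repetition of `τ`. -/
theorem exists_getLast {τ : Dep α} (h : Derivable 𝓡 Γ Q τ) :
    ∃ l : List (Dep α), IsDeduction 𝓡 Γ l ∧ l.getLast? = some τ ∧ ∀ ρ ∈ l, Q ρ := by
  obtain ⟨l, hl, hlQ, hτ⟩ := h
  obtain ⟨i, hi, rfl⟩ := List.mem_iff_getElem.1 hτ
  refine ⟨l ++ [l[i]], hl.append fun j hj => ?_, by simp, fun ρ hρ => ?_⟩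
  · have : [l[i]][j] = l[i] := by simp
    rw [this]
    exact (hl i hi).imp_right fun ⟨P, hP, hmem⟩ =>
      ⟨P, hP, fun τ hτ => Or.inl (List.mem_of_mem_take (hmem τ hτ))⟩
  · rcases List.mem_append.1 hρ with hρ | hρ
    · exact hlQ ρ hρ
    · rw [List.mem_singleton.1 hρ]
      exact hlQ _ hτ

end Derivable

end Deductions

/-! ### The closed theory of a set of dependencies -/

section Theory

variable {α : Type*} [DecidableEq α] (Γ : Set (Dep α)) (S : Set α)

/-- The dependency lies in the class UFD+UIND+IA and uses attributes of `S` only. -/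
def Within (τ : Dep α) : Prop := τ.IsUFDorUINDorIA ∧ τ.attrs ⊆ S

/-- Derivability inside the class and inside the attribute set `S`. -/
abbrev DerivableWithin (τ : Dep α) : Prop := Derivable finRules Γ (Within S) τ

variable {S}

/-- A set of elements of `S`, seen as a set of attributes. -/
abbrev lift (X : Finset S) : Finset α := X.map (Function.Embedding.subtype _)

theorem lift_union (X Y : Finset S) : lift (X ∪ Y) = lift X ∪ lift Y := Finset.map_union _ _

omit [DecidableEq α] in
theorem within_ia (X Y : Finset S) : Within S (.ia (lift X) (lift Y)) :=
  ⟨trivial, by simp [Dep.attrs]⟩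

omit [DecidableEq α] in
theorem within_fd {X Y : Finset S} (hX : X.card ≤ 1) (hY : Y.card ≤ 1) :
    Within S (.fd (lift X) (lift Y)) :=
  ⟨by simpa [Dep.IsUFDorUINDorIA] using ⟨hX, hY⟩, by simp [Dep.attrs]⟩

omit [DecidableEq α] in
theorem within_uind (A B : S) : Within S (.uind A.1 B.1) :=
  ⟨rfl, by
    rintro _ (⟨_, rfl⟩ | ⟨_, rfl⟩)
    exacts [A.2, B.2]⟩

variable {Γ}

omit [DecidableEq α] in
theorem forall_mem_pair {p : Dep α → Prop} {a b : Dep α} (ha : p a) (hb : p b) :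
    ∀ x ∈ ({a, b} : Set (Dep α)), p x := by
  rintro _ (rfl | rfl) <;> assumption

theorem derivable_ia {P : Set (Dep α)} {X Y : Finset S} (hr : AStar P (.ia (lift X) (lift Y)))
    (hP : P.Finite) (h : ∀ ρ ∈ P, DerivableWithin Γ S ρ) :
    DerivableWithin Γ S (.ia (lift X) (lift Y)) :=
  .of_rule (Or.inl hr) (within_ia X Y) hP h

theorem derivable_fd {P : Set (Dep α)} {X Y : Finset S} (hX : X.card ≤ 1) (hY : Y.card ≤ 1)
    (hr : AStar P (.fd (lift X) (lift Y))) (hP : P.Finite)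
    (h : ∀ ρ ∈ P, DerivableWithin Γ S ρ) :
    DerivableWithin Γ S (.fd (lift X) (lift Y)) :=
  .of_rule (Or.inl hr) (within_fd hX hY) hP h

theorem derivable_fd_trans {X Y Z : Finset S} (hX : X.card ≤ 1) (hZ : Z.card ≤ 1)
    (h : DerivableWithin Γ S (.fd (lift X) (lift Y)))
    (h' : DerivableWithin Γ S (.fd (lift Y) (lift Z))) :
    DerivableWithin Γ S (.fd (lift X) (lift Z)) :=
  derivable_fd hX hZ (.transitivity _ (lift Y) _) (by simp) (by simpa using ⟨h, h'⟩)

theorem derivable_fd_empty {X : Finset S} (hX : X.card ≤ 1) :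
    DerivableWithin Γ S (.fd (lift X) (lift (∅ : Finset S))) :=
  derivable_fd hX (by simp) (by simpa using AStar.reflexivity (lift X) ∅) Set.finite_empty
    (by simp)

theorem derivable_comp {X Y Z W : Finset S} (h : DerivableWithin Γ S (.ia (lift X) (lift (Y ∪ Z))))
    (h' : DerivableWithin Γ S (.fd (lift Z) (lift W))) :
    DerivableWithin Γ S (.ia (lift X) (lift (Y ∪ Z ∪ W))) := by
  rw [lift_union] at h
  refine derivable_ia ?_ (Set.toFinite _) (forall_mem_pair h h')
  rw [lift_union, lift_union]
  exact .composition _ _ _ _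

variable (Γ S) in
/-- The dependencies over `S` that are derivable within `S`. -/
def theoryOf : ClosedTheory S where
  const A := DerivableWithin Γ S (.fd (lift ∅) (lift {A}))
  det A B := DerivableWithin Γ S (.fd (lift {A}) (lift {B}))
  sub A B := DerivableWithin Γ S (.uind A B)
  indep X Y := DerivableWithin Γ S (.ia (lift X) (lift Y))
  det_refl A := derivable_fd (by simp) (by simp)
    (by simpa using AStar.reflexivity (lift {A}) (lift {A})) Set.finite_empty (by simp)
  det_trans := derivable_fd_trans (by simp) (by simp)
  det_of_const := derivable_fd_trans (by simp) (by simp) (derivable_fd_empty (by simp))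
  const_of_det := derivable_fd_trans (by simp) (by simp)
  sub_refl A := .of_rule (Or.inr (Or.inl (.reflexivity 1 _))) (within_uind A A) Set.finite_empty
    (by simp)
  sub_trans {A B C} h h' := .of_rule
    (Or.inr (Or.inl (.transitivity 1 _ (Dep.single B.1) _))) (within_uind A C)
    (P := {.uind A B, .uind B C}) (by simp) (by simpa using ⟨h, h'⟩)
  cycle {k} A B hdet hsub i := by
    have hfin : (cyclePremises (fun i => (A i).1) (fun i => (B i).1)).Finite :=
      (Set.finite_range _).union (Set.finite_range _)
    have hall : ∀ ρ ∈ cyclePremises (fun i => (A i).1) (fun i => (B i).1),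
        DerivableWithin Γ S ρ := by
      rintro _ (⟨j, rfl⟩ | ⟨j, rfl⟩)
      · simpa [lift] using hdet j
      · exact hsub j
    constructor
    · have h1 : Within S (.fd (lift {B i}) (lift {A i})) := within_fd (by simp) (by simp)
      have h2 := CycleRule.fd (fun i => (A i).1) (fun i => (B i).1) i
      simp only [lift, Finset.map_singleton, Function.Embedding.subtype_apply] at h1 ⊢
      exact .of_rule (Or.inr (Or.inr ⟨k, h2⟩)) h1 hfin hall
    · exact .of_rule (Or.inr (Or.inr ⟨k, .ind (fun i => (A i).1) (fun i => (B i).1) i⟩))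
        (within_uind _ _) hfin hall
  indep_empty X := derivable_ia (by simpa using AStar.trivialIndependence (lift X))
    Set.finite_empty (by simp)
  indep_symm h := derivable_ia (.symmetry _ _) (by simp) (by simpa using h)
  indep_decomposition {X Y Z} h := derivable_ia (.decomposition _ _ (lift Z)) (by simp)
    (by simpa [lift, Finset.map_union] using h)
  indep_exchange {X Y Z} h h' := by
    rw [lift_union] at h'
    refine derivable_ia ?_ (Set.toFinite _) (forall_mem_pair h h')
    rw [lift_union]
    exact .exchange _ _ _
  indep_constancy {A B} h h' := derivable_fd (by simp) (by simp)
    (by simpa using AStar.constancy (lift {A}) (lift {B})) (by simp) (by simpa using ⟨h, h'⟩)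
  indep_det := derivable_comp
  indep_const {X Y C} h h' := by
    simpa using derivable_comp (Y := Y) (Z := ∅) (by simpa using h) h'

end Theory

/-! ### The Armstrong relation -/

section Armstrong

variable {α V : Type*}

theorem exists_lift {S : Set α} {X : Finset α} (h : ↑X ⊆ S) : ∃ X' : Finset S, X = lift X' := by
  classical
  exact ⟨X.subtype (· ∈ S), (Finset.subtype_map_of_mem h).symm⟩

/-- The dependencies of the class over `S` are those with trivial right-hand side, the ones that a
`ClosedTheory` over `S` speaks about, and no others. -/
theorem Within.cases {S : Set α} {motive : Dep α → Prop}
    (trivial_fd : ∀ X : Finset S, X.card ≤ 1 → motive (.fd (lift X) ∅))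
    (const : ∀ A : S, motive (.fd ∅ {A.1}))
    (det : ∀ A B : S, motive (.fd {A.1} {B.1}))
    (sub : ∀ A B : S, motive (.uind A.1 B.1))
    (indep : ∀ X Y : Finset S, motive (.ia (lift X) (lift Y)))
    {σ : Dep α} (h : Within S σ) : motive σ := by
  obtain ⟨hC, hS⟩ := h
  cases σ with
  | fd X Y =>
    obtain ⟨X, rfl⟩ := exists_lift (Set.union_subset_iff.1 hS).1
    obtain ⟨Y, rfl⟩ := exists_lift (Set.union_subset_iff.1 hS).2
    obtain ⟨hX, hY⟩ := hC
    rw [Finset.card_map] at hX hY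
    have small : ∀ Z : Finset S, Z.card ≤ 1 → Z = ∅ ∨ ∃ A, Z = {A} := fun Z hZ =>
      (Nat.le_one_iff_eq_zero_or_eq_one.1 hZ).imp Finset.card_eq_zero.1 Finset.card_eq_one.1
    rcases small Y hY with rfl | ⟨B, rfl⟩
    · exact trivial_fd X hX
    · rcases small X hX with rfl | ⟨A, rfl⟩
      · simpa using const B
      · simpa using det A B
  | ind n A B =>
    obtain rfl : n = 1 := hC
    obtain ⟨hA, hB⟩ := Set.union_subset_iff.1 hS
    have := sub ⟨A 0, hA ⟨0, rfl⟩⟩ ⟨B 0, hB ⟨0, rfl⟩⟩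
    have e : ∀ A : Fin 1 ↪ α, Dep.single (A 0) = A := by
      intro A; ext i; rw [Subsingleton.elim i 0]; rfl
    simpa [Dep.uind, e] using this
  | ia X Y =>
    obtain ⟨X, rfl⟩ := exists_lift (Set.union_subset_iff.1 hS).1
    obtain ⟨Y, rfl⟩ := exists_lift (Set.union_subset_iff.1 hS).2
    exact indep X Y

/-- Some finite relation satisfies, among the dependencies of the class over `S`, exactly those that
are derivable within `S`. -/
theorem exists_rel_sat_iff_derivableWithin [Finite α] [DecidableEq α] {Dom : α → Set V}
    (hDom : (⋂ A, Dom A).Infinite) (Γ : Set (Dep α)) (S : Set α) :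
    ∃ r : Rel Dom, r.tuples.Finite ∧
      ∀ σ, Within S σ → (r.Sat σ ↔ DerivableWithin Γ S σ) := by
  classical
  obtain ⟨Ω, _, _, t, hconst, hdet, hsub, hindep⟩ := (theoryOf Γ S).exists_realization
  have : Countable (Finset S ⊕ ℕ) := inferInstance
  obtain ⟨g, hg⟩ := Countable.exists_injective_nat (Finset S ⊕ ℕ)
  let e : Finset S ⊕ ℕ → V := fun v => hDom.natEmbedding _ (g v)
  have he : ∀ {v w}, e v = e w ↔ v = w := fun {v w} =>
    ⟨fun h => hg ((hDom.natEmbedding _).injective (Subtype.ext h)), fun h => h ▸ rfl⟩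
  have hmem : ∀ v A, e v ∈ Dom A := fun v A =>
    Set.mem_iInter.1 (hDom.natEmbedding _ (g v)).2 A
  -- Attributes outside `S` get a constant column.
  let u : Ω → α → V := fun x A => if h : A ∈ S then e (t x ⟨A, h⟩) else e (Sum.inr 0)
  have hu : ∀ x (A : S), u x A = e (t x A) := fun x A => dif_pos A.2
  refine ⟨⟨Set.range u, Set.range_nonempty u, ?_⟩, Set.finite_range u, fun σ hσ => ?_⟩
  · rintro _ ⟨x, rfl⟩ A
    simp only [u]
    split_ifs <;> exact hmem _ _
  · refine Within.cases (motive := fun σ => Rel.Sat _ σ ↔ DerivableWithin Γ S σ)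
      ?_ ?_ ?_ ?_ ?_ hσ
    · intro X hX
      exact iff_of_true (by simp [Rel.Sat]) (derivable_fd_empty hX)
    · intro A
      have := hconst A
      simp only [theoryOf, Finset.map_empty, Finset.map_singleton] at this
      refine Iff.trans ?_ this
      simp [Rel.Sat, hu, he]
    · intro A B
      have := hdet A B
      simp only [theoryOf, Finset.map_singleton] at this
      refine Iff.trans ?_ this
      simp [Rel.Sat, hu, he]
    · intro A B
      refine Iff.trans ?_ (hsub A B)
      simp [sat_uind, hu, he]
    · intro X Y
      refine Iff.trans ?_ (hindep X Y)
      simp only [Rel.Sat, Set.forall_mem_range, Set.exists_range_iff, Finset.forall_mem_map,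
        Function.Embedding.subtype_apply, hu, he]

end Armstrong

end DependencyTheory

open DependencyTheory in
theorem mainTheorem1 {α V : Type*} [Finite α] [DecidableEq α]
    (Dom : α → Set V) (hDom : (⋂ A, Dom A).Infinite) :
    -- soundness
    (∀ (Γ : Set (DependencyTheory.Dep α)) (σ : DependencyTheory.Dep α), Γ.Finite →
      (∀ τ ∈ Γ, τ.IsUFDorUINDorIA) → σ.IsUFDorUINDorIA →
      DependencyTheory.Deducible DependencyTheory.finRules Γ σ →
      DependencyTheory.FinImplies Dom Γ σ) ∧
    -- completeness, with attribute-bounded deductions inside the class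
    (∀ (Γ : Set (DependencyTheory.Dep α)) (σ : DependencyTheory.Dep α), Γ.Finite →
      (∀ τ ∈ Γ, τ.IsUFDorUINDorIA) → σ.IsUFDorUINDorIA →
      DependencyTheory.FinImplies Dom Γ σ →
      DependencyTheory.BoundedDeducible DependencyTheory.finRules
        DependencyTheory.Dep.IsUFDorUINDorIA Γ σ) ∧
    -- finite Armstrong relations
    (∀ Γ : Set (DependencyTheory.Dep α), Γ.Finite → (∀ τ ∈ Γ, τ.IsUFDorUINDorIA) →
      ∃ r : DependencyTheory.Rel Dom, r.tuples.Finite ∧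
        DependencyTheory.IsFinArmstrong DependencyTheory.Dep.IsUFDorUINDorIA Γ r) := by
  refine ⟨?_, ?_, ?_⟩
  · rintro Γ σ - - - ⟨l, hl, hlast⟩
    exact finImplies_of_mem_deduction hl (List.mem_of_getLast? hlast)
  · intro Γ σ _ hΓ hσ himp
    let S : Set α := (⋃ γ ∈ Γ, γ.attrs) ∪ σ.attrs
    obtain ⟨r, hr, hsat⟩ := exists_rel_sat_iff_derivableWithin hDom Γ S
    have hΓS : ∀ γ ∈ Γ, Within S γ := fun γ hγ =>
      ⟨hΓ γ hγ, (Set.subset_biUnion_of_mem hγ).trans Set.subset_union_left⟩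
    have hσS : Within S σ := ⟨hσ, Set.subset_union_right⟩
    exact ((hsat σ hσS).1 (himp r hr fun γ hγ =>
      (hsat γ (hΓS γ hγ)).2 (.of_mem hγ (hΓS γ hγ)))).exists_getLast
  · intro Γ _ hΓ
    obtain ⟨r, hr, hsat⟩ := exists_rel_sat_iff_derivableWithin hDom Γ Set.univ
    have hΓS : ∀ γ ∈ Γ, Within Set.univ γ := fun γ hγ => ⟨hΓ γ hγ, Set.subset_univ _⟩
    refine ⟨r, hr, fun σ hσ => ⟨fun h => ?_, fun h => h r hr fun γ hγ =>
      (hsat γ (hΓS γ hγ)).2 (.of_mem hγ (hΓS γ hγ))⟩⟩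
    obtain ⟨l, hl, -, hmem⟩ := (hsat σ ⟨hσ, Set.subset_univ _⟩).1 h
    exact finImplies_of_mem_deduction hl hmem
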